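/- Let $(X,d)$ be a complete separable metric space with its Borel $\sigma$-algebra, and let $\mu$ be a Borel probability measure on $X$ whose support $A=\operatorname{supp}(\mu)$ is compact. Let $(x_i)_{i\in\mathbb N}$ be an independent, identically distributed sequence of random variables with law $\mu$ on a probability space $(\Omega,\mathbb P)$. Put $X_n=\{x_1,\dots,x_n\}$ and $\nu_{X_n}=\frac1n\sum_{i=1}^n\delta_{x_i}$. Then for every $\varepsilon>0$, $$\lim_{n\to\infty}\mathbb P\bigl[d_{HI}(\mathcal{MD}(X_n,\nu_{X_n}),\mathcal{MD}(A,\mu))>\varepsilon\bigr]=0,$$ where the events need not be measurable and $\mathbb P$ is read as the outer measure. Here $T=\,]0,\infty[^{op}\times[0,\infty[$ is ordered by $(m,r)\le(m',r')$ iff $m'\le m$ and $r\le r'$. For $V\subseteq X$ and a Borel measure $\nu$ on $X$, $\mathcal{MD}(V,\nu)_{m,r}$ is the abstract simplicial complex of all non-empty finite $\sigma\subseteq V$ with $\nu(\{y\in X: d(x,y)\le 2r\text{ for all }x\in\sigma\})\ge m$. These complexes increase along $T$; geometric realization (with the weak topology) turns $\mathcal{MD}(V,\nu)$ into a functor $T\to\mathbf{Top}$,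 where $\mathbf{Top}$ is the category of compactly generated weakly Hausdorff spaces and continuous maps. For $\delta>0$, two functors $F',G':T\to\mathbf{Top}$ are $\delta$-interleaved if there is a functor $Z$ from the preordered set $T\times\{0,1\}$ to $\mathbf{Top}$ restricting to $F'$ on $T\times\{0\}$ and to $G'$ on $T\times\{1\}$; the preorder on $T\times\{0,1\}$ is: $((m,r),i)\le((m',r'),j)$ iff either $i=j$ and $(m,r)\le(m',r')$, or $i\ne j$, $m'\le m-\delta$ and $r+\delta\le r'$. Functors $F,F':T\to\mathbf{Top}$ are weakly equivalent, $F\simeq F'$, if they are connected by a finite zigzag of natural transformations of functors $T\to\mathbf{Top}$ all of whose components are homotopy equivalences. The homotopy interleaving distance is $$d_{HI}(F,G)=\inf\{\delta>0:\exists\,F'\simeq F,\ G'\simeq G\text{ such that }F',G'\text{ are }\delta\text{-interleaved}\}\in[0,\infty],\qquad \inf\emptyset=\infty.$$ -/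

import Mathlib

open MeasureTheory ProbabilityTheory Filter Topology CategoryTheory
open scoped NNReal ENNReal

universe u

namespace MeasureDowker

/-! ## Geometric realization of abstract simplicial complexes -/

/-- The closed geometric simplex spanned by the finite vertex set `σ`, in barycentric
coordinates: weight functions on `V` that are nonnegative, vanish off `σ` and sum to `1`.
As a subset of `V → ℝ` it carries the Euclidean topology of a simplex. -/
def geomSimplex {V : Type u} (σ : Finset V) : Set (V → ℝ) :=
  {w | (∀ v, 0 ≤ w v) ∧ (∀ v, v ∉ σ → w v = 0) ∧ ∑ v ∈ σ, w v = 1}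

/-- The points of the geometric realization `|K|`: barycentric coordinates of points lying in a
closed simplex that belongs to `K`. -/
structure Realization {V : Type u} (K : PreAbstractSimplicialComplex V) : Type u where
  weight : V → ℝ
  mem_simplex : ∃ σ ∈ K.faces, weight ∈ geomSimplex σ

namespace Realization

variable {V : Type u} {K L M : PreAbstractSimplicialComplex V}

/-- The inclusion of the closed simplex of a face into the realization. -/
def ofFace (K : PreAbstractSimplicialComplex V) (σ : K.faces) (w : geomSimplex σ.1) :
    Realization K :=
  ⟨w.1, σ.1, σ.2, w.2⟩

/-- The weak (coherent) topology: a set is open (closed) iff its intersection with every closed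
simplex is. -/
instance : TopologicalSpace (Realization K) :=
  ⨆ σ : K.faces, TopologicalSpace.coinduced (ofFace K σ) inferInstance

theorem weight_injective : Function.Injective (weight : Realization K → V → ℝ) := by
  rintro ⟨a, _⟩ ⟨b, _⟩ h
  cases h
  rfl

theorem continuous_ofFace (σ : K.faces) : Continuous (ofFace K σ) :=
  continuous_iff_coinduced_le.2
    (le_iSup (fun σ : K.faces => TopologicalSpace.coinduced (ofFace K σ) inferInstance) σ)

theorem continuous_iff {Y : Type*} [TopologicalSpace Y] {f : Realization K → Y} :
    Continuous f ↔ ∀ σ : K.faces, Continuous (f ∘ ofFace K σ) := by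
  constructor
  · intro h σ
    exact h.comp (continuous_ofFace σ)
  · intro h
    refine continuous_iSup_dom.2 fun σ => ?_
    exact continuous_coinduced_dom.2 (h σ)

theorem continuous_weight : Continuous (weight : Realization K → V → ℝ) :=
  continuous_iff.2 fun _ => continuous_subtype_val

instance : T2Space (Realization K) :=
  T2Space.of_injective_continuous weight_injective continuous_weight

/-- The map `|K| → |L|` induced by the inclusion of a subcomplex `K ≤ L`. -/
def map (h : K ≤ L) (p : Realization K) : Realization L :=
  ⟨p.weight, p.mem_simplex.imp fun _ hσ => ⟨h hσ.1, hσ.2⟩⟩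

theorem continuous_map (h : K ≤ L) : Continuous (map h) :=
  continuous_iff.2 fun σ => continuous_ofFace (K := L) ⟨σ.1, h σ.2⟩

end Realization

theorem isCompact_geomSimplex {V : Type u} (σ : Finset V) : IsCompact (geomSimplex σ) := by
  have hc : IsClosed (geomSimplex σ) := by
    have h1 : IsClosed {w : V → ℝ | ∀ v, 0 ≤ w v} := by
      rw [Set.ofPred_forall]
      exact isClosed_iInter fun v => isClosed_le continuous_const (continuous_apply v)
    have h2 : IsClosed {w : V → ℝ | ∀ v, v ∉ σ → w v = 0} := by
      simp only [Set.ofPred_forall]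
      exact isClosed_iInter fun v => isClosed_iInter fun _ =>
        isClosed_eq (continuous_apply v) continuous_const
    have h3 : IsClosed {w : V → ℝ | ∑ v ∈ σ, w v = 1} :=
      isClosed_eq (continuous_finsetSum _ fun v _ => continuous_apply v) continuous_const
    exact h1.inter (h2.inter h3)
  refine (isCompact_univ_pi (fun _ : V => isCompact_Icc (a := (0 : ℝ)) (b := 1))).of_isClosed_subset
    hc ?_
  rintro w ⟨h0, hz, hs⟩ v -
  refine ⟨h0 v, ?_⟩
  by_cases hv : v ∈ σ
  · rw [← hs]
    exact Finset.single_le_sum (fun i _ => h0 i) hv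
  · rw [hz v hv]
    exact zero_le_one

/-! ## The category of compactly generated weakly Hausdorff spaces -/

/-- Weakly Hausdorff: continuous images of compact Hausdorff spaces are closed. -/
def IsWeaklyHausdorff (X : Type u) [TopologicalSpace X] : Prop :=
  ∀ (S : Type u) [TopologicalSpace S] [CompactSpace S] [T2Space S] (f : S → X),
    Continuous f → IsClosed (Set.range f)

/-- The property of being compactly generated and weakly Hausdorff. -/
def isCGWH : ObjectProperty TopCat.{u} :=
  fun X => CompactlyGeneratedSpace X ∧ IsWeaklyHausdorff X

/-- The category of compactly generated weakly Hausdorff spaces and continuous maps. -/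
abbrev CGWH : Type (u + 1) := isCGWH.{u}.FullSubcategory

theorem isCGWH_realization {V : Type u} (K : PreAbstractSimplicialComplex V) :
    isCGWH (TopCat.of (Realization K)) := by
  constructor
  · refine compactlyGeneratedSpace_of_isClosed (X := Realization K) fun s hs => ?_
    refine isClosed_iSup_iff.2 fun σ => isClosed_coinduced.2 ?_
    have : CompactSpace (geomSimplex σ.1) := isCompact_iff_compactSpace.1 (isCompact_geomSimplex _)
    exact hs (CompHaus.of (geomSimplex σ.1)) (Realization.ofFace K σ)
      (Realization.continuous_ofFace σ)
  · intro S _ _ _ f hf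
    exact (isCompact_range hf).isClosed

/-- Geometric realization, as a functor on the poset of simplicial complexes with vertices in `V`
(ordered by inclusion). -/
def realization (V : Type u) : PreAbstractSimplicialComplex V ⥤ CGWH.{u} where
  obj K := ⟨TopCat.of (Realization K), isCGWH_realization K⟩
  map h := ObjectProperty.homMk
    (TopCat.ofHom ⟨Realization.map h.le, Realization.continuous_map h.le⟩)
  map_id _ := rfl
  map_comp _ _ := rfl

/-! ## The measure Dowker bifiltration -/

/-- The indexing poset `]0,∞[ᵒᵖ × [0,∞[` of bifiltrations. -/
@[ext]
structure BiIndex : Type where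
  mass : ℝ
  radius : ℝ
  mass_pos : 0 < mass
  radius_nonneg : 0 ≤ radius

instance : PartialOrder BiIndex where
  le s t := t.mass ≤ s.mass ∧ s.radius ≤ t.radius
  le_refl _ := ⟨le_rfl, le_rfl⟩
  le_trans _ _ _ h k := ⟨k.1.trans h.1, h.2.trans k.2⟩
  le_antisymm _ _ h k := BiIndex.ext (le_antisymm k.1 h.1) (le_antisymm h.2 k.2)

/-- The simplicial complex at index `(m, r)` of the measure Dowker bifiltration of a vertex set
`V`, a measure `μ` on `Y` and a function `Λ` on `V × Y`: a non-empty finite `σ ⊆ V` is a simplex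
iff `μ {y | Λ (x, y) ≤ 2 r for all x ∈ σ} ≥ m`. -/
def dowkerComplex {V : Type u} {Y : Type*} [MeasurableSpace Y] (μ : Measure Y) (Λ : V → Y → ℝ)
    (t : BiIndex) : PreAbstractSimplicialComplex V where
  faces := {σ | σ.Nonempty ∧ ENNReal.ofReal t.mass ≤ μ {y | ∀ x ∈ σ, Λ x y ≤ 2 * t.radius}}
  isRelLowerSet_faces := fun _ hσ => ⟨hσ.1, fun _ hτσ hτ =>
    ⟨hτ, hσ.2.trans (measure_mono fun _ hy x hx => hy x (hτσ hx))⟩⟩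

theorem dowkerComplex_mono {V : Type u} {Y : Type*} [MeasurableSpace Y] (μ : Measure Y)
    (Λ : V → Y → ℝ) : Monotone (dowkerComplex μ Λ) := fun _ _ hst _ hσ =>
  ⟨hσ.1, (ENNReal.ofReal_le_ofReal hst.1).trans (hσ.2.trans (measure_mono fun _ hy x hx =>
    (hy x hx).trans (mul_le_mul_of_nonneg_left hst.2 zero_le_two)))⟩

/-- The (realized) measure Dowker bifiltration `MD(A, μ)` of a subset `A` of a metric space `Z`
with a measure `μ` on `Z`, with respect to the distance function. -/
def MD {Z : Type u} [MetricSpace Z] [MeasurableSpace Z] (A : Set Z) (μ : Measure Z) :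
    BiIndex ⥤ CGWH.{u} :=
  (dowkerComplex_mono (V := A) μ (fun x y => dist (x : Z) y)).functor ⋙ realization A

/-! ## The homotopy interleaving distance -/

/-- A natural transformation `η : F ⟶ G` all of whose components are homotopy equivalences. -/
def IsObjectwiseEquivalence {F G : BiIndex ⥤ CGWH.{u}} (η : F ⟶ G) : Prop :=
  ∀ t : BiIndex, ∃ e : ContinuousMap.HomotopyEquiv (F.obj t).obj (G.obj t).obj,
    e.toFun = (η.app t).hom.hom

/-- Weak equivalence of functors: a finite zigzag of objectwise equivalences. -/
def WeaklyEquivalent : (BiIndex ⥤ CGWH.{u}) → (BiIndex ⥤ CGWH.{u}) → Prop :=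
  Relation.EqvGen fun F G => ∃ η : F ⟶ G, IsObjectwiseEquivalence η

/-- The objects `]0,∞[ᵒᵖ × [0,∞[ × {0,1}` of the `δ`-interleaving category. -/
structure InterleavingIndex (δ : ℝ≥0) : Type where
  index : BiIndex
  side : Fin 2

/-- The `δ`-interleaving category is thin: there is a morphism `(s, i) ⟶ (t, j)` iff `i = j` and
`s ≤ t`, or `i ≠ j` and `s` shifted by `δ`, i.e. `(m - δ, r + δ)`, is at most `t`. -/
instance (δ : ℝ≥0) : Preorder (InterleavingIndex δ) where
  le a b := (a.side = b.side ∧ a.index ≤ b.index) ∨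
    (a.side ≠ b.side ∧ b.index.mass ≤ a.index.mass - δ ∧ a.index.radius + δ ≤ b.index.radius)
  le_refl _ := Or.inl ⟨rfl, le_rfl⟩
  le_trans := by
    rintro ⟨a, i⟩ ⟨b, j⟩ ⟨c, k⟩ h h'
    have hδ : (0 : ℝ) ≤ δ := δ.2
    rcases h with ⟨e, h1, h2⟩ | ⟨e, h1, h2⟩ <;> rcases h' with ⟨e', h1', h2'⟩ | ⟨e', h1', h2'⟩ <;>
      dsimp only at *
    · exact Or.inl ⟨e.trans e', h1'.trans h1, h2.trans h2'⟩
    · exact Or.inr ⟨e ▸ e', by linarith, by linarith⟩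
    · exact Or.inr ⟨e' ▸ e, by linarith, by linarith⟩
    · exact Or.inl ⟨by omega, by linarith, by linarith⟩

/-- The inclusion `E_i` of the index poset into the `δ`-interleaving category. -/
def interleavingInclusion (δ : ℝ≥0) (i : Fin 2) : BiIndex ⥤ InterleavingIndex δ :=
  Monotone.functor (f := fun t => (⟨t, i⟩ : InterleavingIndex δ)) fun _ _ h => Or.inl ⟨rfl, h⟩

/-- `F` and `G` are `δ`-interleaved. -/
def Interleaved (δ : ℝ≥0) (F G : BiIndex ⥤ CGWH.{u}) : Prop :=
  ∃ Z : InterleavingIndex δ ⥤ CGWH.{u},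
    F = interleavingInclusion δ 0 ⋙ Z ∧ G = interleavingInclusion δ 1 ⋙ Z

/-- `F` and `G` are `δ`-homotopy-interleaved. -/
def HomotopyInterleaved (δ : ℝ≥0) (F G : BiIndex ⥤ CGWH.{u}) : Prop :=
  ∃ F' G' : BiIndex ⥤ CGWH.{u},
    WeaklyEquivalent F' F ∧ WeaklyEquivalent G' G ∧ Interleaved δ F' G'

/-- The homotopy interleaving distance, with value `∞` if there is no homotopy interleaving. -/
noncomputable def dHI (F G : BiIndex ⥤ CGWH.{u}) : ℝ≥0∞ :=
  ⨅ (δ : ℝ≥0) (_ : 0 < δ ∧ HomotopyInterleaved δ F G), (δ : ℝ≥0∞)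

/-! ## Empirical data -/

/-- The empirical probability measure of the first `n` sample points (with multiplicities). -/
noncomputable def empiricalMeasure {X : Type*} [MeasurableSpace X] (x : ℕ → X) (n : ℕ) :
    Measure X :=
  (n : ℝ≥0∞)⁻¹ • ∑ i ∈ Finset.range n, Measure.dirac (x i)

/-- The set of the first `n` sample points. -/
def sampleSet {X : Type*} (x : ℕ → X) (n : ℕ) : Set X :=
  x '' Set.Iio n

end MeasureDowker

namespace MeasureDowker

/-! ## Simplicial maps and contiguity -/

/-! Almost surely every sample point lies in the support `A`. Once the sample is `ε`-dense in `A`, a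
retraction `φ` of `A` onto it moves points by at most `ε`. Pulling the sample complexes back along
`φ` only duplicates vertices, so homotopy types are unchanged (`exists_homotopyEquiv_comapComplex`).
Both bifiltrations then live on the vertex set `A`, where plain inclusions interleave them, provided
each measure of any set is at most the other measure of its `ε`-thickening plus `ε` (`dHI_MD_le`).
By compactness, finitely many balls of radius `ε / 2` cover `A`. Density and closeness of measures
both follow if the empirical measure is near `μ` on the finitely many unions of these balls
(`measure_le_thickening_add`, `dHI_sample_le`). The law of large numbers makes this likely for each
union, and a union bound finishes. -/

open Classical in
/-- The push-forward of a finitely supported weight function along a map of vertices. -/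
noncomputable def pushWeight {V W : Type*} (φ : W → V) (w : W → ℝ) (v : V) : ℝ :=
  ∑ᶠ x, if φ x = v then w x else 0

open Classical in
theorem pushWeight_eq_sum {V W : Type*} (φ : W → V) {σ : Finset W} {w : W → ℝ}
    (hw : ∀ x, x ∉ σ → w x = 0) (v : V) :
    pushWeight φ w v = ∑ x ∈ σ, if φ x = v then w x else 0 := by
  refine finsum_eq_sum_of_support_subset _ fun x hx => ?_
  by_contra h
  simp [hw x h] at hx

open Classical in
theorem pushWeight_mem_geomSimplex {V W : Type u} (φ : W → V) {σ : Finset W} {w : W → ℝ}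
    (hw : w ∈ geomSimplex σ) : pushWeight φ w ∈ geomSimplex (σ.image φ) := by
  obtain ⟨h0, hz, hs⟩ := hw
  refine ⟨fun v => ?_, fun v hv => ?_, ?_⟩
  · rw [pushWeight_eq_sum φ hz]
    exact Finset.sum_nonneg fun x _ => by split_ifs <;> simp [h0]
  · rw [pushWeight_eq_sum φ hz]
    refine Finset.sum_eq_zero fun x hx => if_neg ?_
    rintro rfl
    exact hv (Finset.mem_image_of_mem φ hx)
  · simp_rw [pushWeight_eq_sum φ hz]
    rw [Finset.sum_comm, ← hs]
    refine Finset.sum_congr rfl fun x hx => ?_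
    rw [Finset.sum_ite_eq, if_pos (Finset.mem_image_of_mem φ hx)]

theorem geomSimplex_mono {V : Type u} {σ τ : Finset V} (h : σ ⊆ τ) :
    geomSimplex σ ⊆ geomSimplex τ := by
  rintro w ⟨h0, hz, hs⟩
  refine ⟨h0, fun v hv => hz v fun hv' => hv (h hv'), ?_⟩
  rw [← hs]
  exact (Finset.sum_subset h fun v _ hv => hz v hv).symm

theorem convex_geomSimplex {V : Type u} (σ : Finset V) : Convex ℝ (geomSimplex σ) := by
  rintro w ⟨h0, hz, hs⟩ w' ⟨h0', hz', hs'⟩ a b ha hb hab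
  refine ⟨fun v => ?_, fun v hv => ?_, ?_⟩
  · have := h0 v
    have := h0' v
    simp only [Pi.add_apply, Pi.smul_apply, smul_eq_mul]
    positivity
  · simp [hz v hv, hz' v hv]
  · simp [Finset.sum_add_distrib, ← Finset.mul_sum, hs, hs', hab]

namespace Realization

variable {V W : Type u} {K : PreAbstractSimplicialComplex V} {L : PreAbstractSimplicialComplex W}

/-- Coordinatewise continuity does not suffice for the weak topology in general; it does when the
image stays in a single closed simplex. -/
theorem continuous_mk_of_mem {Y : Type*} [TopologicalSpace Y] {τ : Finset V} (hτ : τ ∈ K.faces)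
    {g : Y → V → ℝ} (hg : Continuous g) (h : ∀ y, g y ∈ geomSimplex τ) :
    Continuous fun y => (⟨g y, τ, hτ, h y⟩ : Realization K) :=
  (continuous_ofFace (K := K) ⟨τ, hτ⟩).comp (hg.subtype_mk h)

open Classical in
/-- The map of realizations induced by a simplicial map. -/
noncomputable def push (φ : W → V) (h : ∀ σ ∈ L.faces, σ.image φ ∈ K.faces) :
    C(Realization L, Realization K) where
  toFun p := ⟨pushWeight φ p.weight, by
    obtain ⟨σ, hσ, hp⟩ := p.mem_simplex
    exact ⟨σ.image φ, h σ hσ, pushWeight_mem_geomSimplex φ hp⟩⟩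
  continuous_toFun := by
    refine continuous_iff.2 fun σ => continuous_mk_of_mem (h σ.1 σ.2) ?_
      fun w => pushWeight_mem_geomSimplex φ w.2
    refine continuous_pi fun v => ?_
    have : (fun w : geomSimplex σ.1 => pushWeight φ w.1 v) =
        fun w => ∑ x ∈ σ.1, if φ x = v then w.1 x else 0 :=
      funext fun w => pushWeight_eq_sum φ w.2.2.1 v
    change Continuous fun w : geomSimplex σ.1 => pushWeight φ w.1 v
    rw [this]
    refine continuous_finsetSum _ fun x _ => ?_
    split_ifs
    · exact (continuous_apply x).comp continuous_subtype_val
    · exact continuous_const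

/-- Two maps of realizations that carry each closed simplex into a common closed simplex are
homotopic, by the straight-line homotopy. -/
theorem homotopic_of_contiguous (f g : C(Realization L, Realization K))
    (h : ∀ σ ∈ L.faces, ∃ τ ∈ K.faces, ∀ p : Realization L, p.weight ∈ geomSimplex σ →
      (f p).weight ∈ geomSimplex τ ∧ (g p).weight ∈ geomSimplex τ) : f.Homotopic g := by
  have hmem : ∀ (τ : Finset V) (a b : V → ℝ), a ∈ geomSimplex τ → b ∈ geomSimplex τ →
      ∀ t : unitInterval, (1 - t : ℝ) • a + (t : ℝ) • b ∈ geomSimplex τ := fun τ a b ha hb t =>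
    convex_geomSimplex τ ha hb (sub_nonneg.2 t.2.2) t.2.1 (by ring)
  let H (p : Realization L) (t : unitInterval) : Realization K :=
    ⟨(1 - t : ℝ) • (f p).weight + (t : ℝ) • (g p).weight, by
      obtain ⟨σ, hσ, hp⟩ := p.mem_simplex
      obtain ⟨τ, hτ, hfg⟩ := h σ hσ
      exact ⟨τ, hτ, hmem τ _ _ (hfg p hp).1 (hfg p hp).2 t⟩⟩
  have hcell : ∀ σ : L.faces,
      Continuous fun q : geomSimplex σ.1 × unitInterval => H (ofFace L σ q.1) q.2 := by
    intro σ
    obtain ⟨τ, hτ, hfg⟩ := h σ.1 σ.2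
    refine continuous_mk_of_mem hτ (g := fun q : geomSimplex σ.1 × unitInterval =>
      (1 - q.2 : ℝ) • (f (ofFace L σ q.1)).weight + (q.2 : ℝ) • (g (ofFace L σ q.1)).weight) ?_
      fun q => hmem τ _ _ (hfg _ q.1.2).1 (hfg _ q.1.2).2 q.2
    have hw (k : C(Realization L, Realization K)) :
        Continuous fun q : geomSimplex σ.1 × unitInterval => (k (ofFace L σ q.1)).weight :=
      continuous_weight.comp (k.continuous.comp ((continuous_ofFace σ).comp continuous_fst))
    have ht : Continuous fun q : geomSimplex σ.1 × unitInterval => (q.2 : ℝ) :=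
      continuous_subtype_val.comp continuous_snd
    exact ((continuous_const.sub ht).smul (hw f)).add (ht.smul (hw g))
  have hHp (p : Realization L) : Continuous (H p) := by
    obtain ⟨σ, hσ, hp⟩ := p.mem_simplex
    exact (hcell ⟨σ, hσ⟩).comp
      (continuous_const.prodMk continuous_id : Continuous fun t => ((⟨p.weight, hp⟩ : _), t))
  -- Currying avoids describing the topology of the product with the interval: continuity of `F` is
  -- checked simplex by simplex, and local compactness of the interval permits uncurrying.
  let F (p : Realization L) : C(unitInterval, Realization K) := ⟨H p, hHp p⟩
  have hF : Continuous F := continuous_iff.2 fun σ =>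
    ContinuousMap.continuous_of_continuous_uncurry _ (hcell σ)
  have hH : Continuous fun q : unitInterval × Realization L => H q.2 q.1 :=
    (ContinuousMap.continuous_uncurry_of_continuous ⟨F, hF⟩).comp continuous_swap
  refine ⟨⟨⟨fun q => H q.2 q.1, hH⟩, fun p => ?_, fun p => ?_⟩⟩
  · exact weight_injective (by simp [H])
  · exact weight_injective (by simp [H])

end Realization

open Classical in
/-- The pull-back of a simplicial complex along a map of vertex sets. -/
def comapComplex {V W : Type u} (φ : W → V) (K : PreAbstractSimplicialComplex V) :
    PreAbstractSimplicialComplex W where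
  faces := {σ | σ.image φ ∈ K.faces}
  isRelLowerSet_faces := fun _ hσ =>
    ⟨Finset.image_nonempty.1 (K.isRelLowerSet_faces hσ).1, fun _ hτσ hτ =>
      (K.isRelLowerSet_faces hσ).2 (Finset.image_subset_image hτσ) (Finset.image_nonempty.2 hτ)⟩

theorem comapComplex_mono {V W : Type u} (φ : W → V) : Monotone (comapComplex φ) :=
  fun _ _ h _ hσ => h hσ

open Classical in
/-- Pulling back a simplicial complex along a surjection of vertex sets does not change the
homotopy type of its realization. -/
theorem exists_homotopyEquiv_comapComplex {V W : Type u} {φ : W → V}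
    (hφ : Function.Surjective φ) (K : PreAbstractSimplicialComplex V) :
    ∃ e : ContinuousMap.HomotopyEquiv (Realization (comapComplex φ K)) (Realization K),
      e.toFun = Realization.push φ (fun _ h => h) := by
  obtain ⟨s, hs⟩ := hφ.hasRightInverse
  have himage (σ : Finset V) : (σ.image s).image φ = σ := by
    rw [Finset.image_image, hs.comp_eq_id, Finset.image_id]
  have hsK : ∀ σ ∈ K.faces, σ.image s ∈ (comapComplex φ K).faces := fun σ hσ => by
    change (σ.image s).image φ ∈ K.faces
    rwa [himage]
  refine ⟨⟨Realization.push φ (fun _ h => h), Realization.push s hsK, ?_, ?_⟩, rfl⟩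
  -- The added vertices `s (φ x)` have the same images under `φ` as those of `σ`, so the union is
  -- still a face of the pull-back.
  · refine Realization.homotopic_of_contiguous _ _ fun σ hσ =>
      ⟨σ ∪ (σ.image φ).image s, ?_, fun p hp => ⟨?_, ?_⟩⟩
    · change (σ ∪ (σ.image φ).image s).image φ ∈ K.faces
      rw [Finset.image_union, himage, Finset.union_self]
      exact hσ
    · exact geomSimplex_mono Finset.subset_union_right
        (pushWeight_mem_geomSimplex s (pushWeight_mem_geomSimplex φ hp))
    · exact geomSimplex_mono Finset.subset_union_left hp
  · refine Realization.homotopic_of_contiguous _ _ fun σ hσ => ⟨σ, hσ, fun p hp => ⟨?_, hp⟩⟩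
    have := pushWeight_mem_geomSimplex φ (pushWeight_mem_geomSimplex s hp)
    rwa [himage] at this

/-! ## Homotopy interleavings from vertex maps -/

/-- The pull-back of a filtered complex along a surjection of vertex sets is weakly equivalent to
the filtered complex. -/
theorem weaklyEquivalent_comapComplex {V W : Type u} {φ : W → V} (hφ : Function.Surjective φ)
    {K : BiIndex → PreAbstractSimplicialComplex V} (hK : Monotone K) :
    WeaklyEquivalent (((comapComplex_mono φ).comp hK).functor ⋙ realization W)
      (hK.functor ⋙ realization V) := by
  refine Relation.EqvGen.rel _ _ ⟨⟨fun t => ObjectProperty.homMk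
    (TopCat.ofHom (Realization.push φ (fun _ h => h))), fun _ _ _ => rfl⟩, fun t => ?_⟩
  exact exists_homotopyEquiv_comapComplex hφ (K t)

/-- With a common vertex set the interleaving factors through the poset of complexes, so
functoriality reduces to monotonicity of one map. -/
theorem interleaved_of_le {V : Type u} (δ : ℝ≥0) {K L : BiIndex → PreAbstractSimplicialComplex V}
    (hK : Monotone K) (hL : Monotone L)
    (hKL : ∀ s t : BiIndex, t.mass ≤ s.mass - δ → s.radius + δ ≤ t.radius → K s ≤ L t)
    (hLK : ∀ s t : BiIndex, t.mass ≤ s.mass - δ → s.radius + δ ≤ t.radius → L s ≤ K t) :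
    Interleaved δ (hK.functor ⋙ realization V) (hL.functor ⋙ realization V) := by
  let M (a : InterleavingIndex δ) : PreAbstractSimplicialComplex V :=
    if a.side = 0 then K a.index else L a.index
  have hM : Monotone M := by
    rintro ⟨s, i⟩ ⟨t, j⟩ h
    rcases h with ⟨e, h⟩ | ⟨e, h1, h2⟩ <;> dsimp only at *
    · subst e
      fin_cases i
      · exact hK h
      · exact hL h
    · fin_cases i <;> fin_cases j
      · exact absurd rfl e
      · exact hKL s t h1 h2
      · exact hLK s t h1 h2
      · exact absurd rfl e
  exact ⟨hM.functor ⋙ realization V, rfl, rfl⟩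

theorem dHI_le_of_homotopyInterleaved {F G : BiIndex ⥤ CGWH.{u}} {ε : ℝ} (hε : 0 < ε)
    (h : HomotopyInterleaved ε.toNNReal F G) : dHI F G ≤ ENNReal.ofReal ε :=
  iInf₂_le ε.toNNReal ⟨Real.toNNReal_pos.2 hε, h⟩

-- This is why `dowkerComplex` admits an arbitrary `Λ`: a pull-back is again a Dowker complex,
-- though no longer that of a metric.
open Classical in
theorem comapComplex_dowkerComplex {V W : Type u} {Y : Type*} [MeasurableSpace Y] (φ : W → V)
    (ν : Measure Y) (Λ : V → Y → ℝ) (t : BiIndex) :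
    comapComplex φ (dowkerComplex ν Λ t) = dowkerComplex ν (fun x => Λ (φ x)) t := by
  ext σ
  simp [comapComplex, dowkerComplex]

/-- The slack `2 * ε` is what the threshold `2 * r` gains when `r` grows by `ε`; hence the thickened
witness set of a simplex still witnesses it. -/
theorem dowkerComplex_le_of_thickening {W : Type u} {Y : Type*} [PseudoMetricSpace Y]
    [MeasurableSpace Y] {μ ν : Measure Y} {Λ Λ' : W → Y → ℝ} {ε : ℝ} (hε : 0 ≤ ε)
    (hΛ : ∀ x y z, dist z y < ε → Λ' x z ≤ Λ x y + 2 * ε)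
    (h : ∀ C : Set Y, μ C ≤ ν (Metric.thickening ε C) + ENNReal.ofReal ε) {s t : BiIndex}
    (hm : t.mass ≤ s.mass - ε) (hr : s.radius + ε ≤ t.radius) :
    dowkerComplex μ Λ s ≤ dowkerComplex ν Λ' t := by
  rintro σ ⟨hσ, hs⟩
  refine ⟨hσ, ?_⟩
  calc ENNReal.ofReal t.mass ≤ ENNReal.ofReal s.mass - ENNReal.ofReal ε := by
        rw [← ENNReal.ofReal_sub _ hε]
        exact ENNReal.ofReal_le_ofReal hm
    _ ≤ ν (Metric.thickening ε {y | ∀ x ∈ σ, Λ x y ≤ 2 * s.radius}) :=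
        tsub_le_iff_right.2 (hs.trans (h _))
    _ ≤ ν {z | ∀ x ∈ σ, Λ' x z ≤ 2 * t.radius} := measure_mono fun z hz x hx => by
        obtain ⟨y, hy, hzy⟩ := Metric.mem_thickening_iff.1 hz
        linarith [hΛ x y z hzy, hy x hx]

/-- Deterministic stability: closeness of vertex sets and of measures bounds the homotopy
interleaving distance of measure Dowker bifiltrations. -/
theorem dHI_MD_le {X : Type u} [MetricSpace X] [MeasurableSpace X] {A B : Set X}
    {μ ν : Measure X} {ε : ℝ} (hε : 0 < ε) {φ : A → B} (hφ : Function.Surjective φ)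
    (hφε : ∀ a, dist (φ a : X) a ≤ ε)
    (hμν : ∀ C : Set X, μ C ≤ ν (Metric.thickening ε C) + ENNReal.ofReal ε)
    (hνμ : ∀ C : Set X, ν C ≤ μ (Metric.thickening ε C) + ENNReal.ofReal ε) :
    dHI (MD B ν) (MD A μ) ≤ ENNReal.ofReal ε := by
  refine dHI_le_of_homotopyInterleaved hε ⟨_, _, weaklyEquivalent_comapComplex hφ _,
    Relation.EqvGen.refl _, interleaved_of_le _ _ _ ?_ ?_⟩
  all_goals
    intro s t hm hr
    rw [Real.coe_toNNReal _ hε.le] at hm hr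
    simp only [Function.comp_apply, comapComplex_dowkerComplex]
  -- Of the slack `2 * ε`, one `ε` pays for moving `x` to `φ x` and the other for moving `y` to `z`.
  · refine dowkerComplex_le_of_thickening hε.le (fun x y z hzy => ?_) hνμ hm hr
    linarith [dist_triangle4 (x : X) (φ x) y z, hφε x, dist_comm (x : X) (φ x), dist_comm z y]
  · refine dowkerComplex_le_of_thickening hε.le (fun x y z hzy => ?_) hμν hm hr
    linarith [dist_triangle4 (φ x : X) x y z, hφε x, dist_comm z y]

/-- Surjectivity comes from choosing `φ` to fix every point of `B`. -/
theorem exists_surjective_dist_le {X : Type*} [PseudoMetricSpace X] {A B : Set X} {ε : ℝ}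
    (hε : 0 ≤ ε) (hBA : B ⊆ A) (h : ∀ a ∈ A, ∃ b ∈ B, dist b a ≤ ε) :
    ∃ φ : A → B, Function.Surjective φ ∧ ∀ a, dist (φ a : X) a ≤ ε := by
  have h' : ∀ a : A, ∃ b : B, dist (b : X) a ≤ ε ∧ ((a : X) ∈ B → (b : X) = a) := by
    intro a
    by_cases ha : (a : X) ∈ B
    · exact ⟨⟨a, ha⟩, by simpa using hε, fun _ => rfl⟩
    · obtain ⟨b, hb, hba⟩ := h a a.2
      exact ⟨⟨b, hb⟩, hba, fun h => absurd h ha⟩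
  choose φ hφ hφB using h'
  exact ⟨φ, fun b => ⟨⟨b, hBA b.2⟩, Subtype.ext (hφB _ b.2)⟩, hφ⟩

/-- Comparing two measures on finite unions of small balls compares them on all sets, up to a
thickening. -/
theorem measure_le_thickening_add {X : Type*} [PseudoMetricSpace X] [MeasurableSpace X]
    {μ ν : Measure X} {A : Set X} (hA : μ Aᶜ = 0) {ε : ℝ} {η : ℝ≥0∞} {t : Finset X}
    (hcover : A ⊆ ⋃ a ∈ t, Metric.ball a (ε / 2))
    (h : ∀ S ⊆ t, μ (⋃ a ∈ S, Metric.ball a (ε / 2)) ≤ ν (⋃ a ∈ S, Metric.ball a (ε / 2)) + η)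
    (C : Set X) : μ C ≤ ν (Metric.thickening ε C) + η := by
  classical
  -- The balls meeting `C` cover `C ∩ A`, and two points of one ball are less than `ε` apart, so
  -- their union stays in the thickening. `C` need not be measurable.
  set S := t.filter fun a => (Metric.ball a (ε / 2) ∩ C).Nonempty
  have h1 : C ⊆ (⋃ a ∈ S, Metric.ball a (ε / 2)) ∪ Aᶜ := by
    intro y hy
    by_cases hyA : y ∈ A
    · obtain ⟨a, ha, hya⟩ := Set.mem_iUnion₂.1 (hcover hyA)
      exact Or.inl (Set.mem_iUnion₂.2 ⟨a, Finset.mem_filter.2 ⟨ha, y, hya, hy⟩, hya⟩)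
    · exact Or.inr hyA
  have h2 : ⋃ a ∈ S, Metric.ball a (ε / 2) ⊆ Metric.thickening ε C := by
    intro z hz
    obtain ⟨a, ha, hza⟩ := Set.mem_iUnion₂.1 hz
    obtain ⟨y, hya, hy⟩ := (Finset.mem_filter.1 ha).2
    refine Metric.mem_thickening_iff.2 ⟨y, hy, ?_⟩
    linarith [dist_triangle_right z y a, Metric.mem_ball.1 hza, Metric.mem_ball.1 hya]
  calc μ C ≤ μ (⋃ a ∈ S, Metric.ball a (ε / 2)) + μ Aᶜ :=
        (measure_mono h1).trans (measure_union_le _ _)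
    _ = μ (⋃ a ∈ S, Metric.ball a (ε / 2)) := by rw [hA, add_zero]
    _ ≤ ν (⋃ a ∈ S, Metric.ball a (ε / 2)) + η := h S (Finset.filter_subset _ _)
    _ ≤ _ := add_le_add_left (measure_mono h2) _

/-! ## Empirical measures -/

section Empirical

variable {X : Type*} [MeasurableSpace X]

theorem empiricalMeasure_apply (x : ℕ → X) (n : ℕ) {U : Set X} (hU : MeasurableSet U) :
    empiricalMeasure x n U = (n : ℝ≥0∞)⁻¹ * ∑ i ∈ Finset.range n, U.indicator 1 (x i) := by
  simp [empiricalMeasure, Measure.dirac_apply' _ hU]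

instance (x : ℕ → X) (n : ℕ) : IsFiniteMeasure (empiricalMeasure x n) := by
  refine ⟨?_⟩
  rw [empiricalMeasure_apply x n MeasurableSet.univ]
  -- The inequality also covers `n = 0`, where the total mass is `∞ * 0 = 0`.
  simpa using (ENNReal.inv_mul_le_one (n : ℝ≥0∞)).trans_lt ENNReal.one_lt_top

theorem empiricalMeasure_real_apply (x : ℕ → X) (n : ℕ) {U : Set X} (hU : MeasurableSet U) :
    (empiricalMeasure x n).real U = (∑ i ∈ Finset.range n, U.indicator 1 (x i)) / n := by
  classical
  rw [measureReal_def, empiricalMeasure_apply x n hU, ENNReal.toReal_mul, ENNReal.toReal_sum,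
    ENNReal.toReal_inv, ENNReal.toReal_natCast, div_eq_inv_mul]
  · congr 1
    refine Finset.sum_congr rfl fun i _ => ?_
    by_cases h : x i ∈ U <;> simp [h]
  · intro i _
    by_cases h : x i ∈ U <;> simp [h]

theorem empiricalMeasure_eq_zero {x : ℕ → X} {n : ℕ} {U : Set X} (hU : MeasurableSet U)
    (h : ∀ i < n, x i ∉ U) : empiricalMeasure x n U = 0 := by
  rw [empiricalMeasure_apply x n hU, Finset.sum_eq_zero, mul_zero]
  exact fun i hi => Set.indicator_of_notMem (h i (Finset.mem_range.1 hi)) _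

/-- The weak law of large numbers for empirical measures. -/
theorem tendstoInMeasure_empiricalMeasure {μ : Measure X} [IsProbabilityMeasure μ]
    {Ω : Type*} [MeasurableSpace Ω] {P : Measure Ω} [IsProbabilityMeasure P]
    {x : ℕ → Ω → X} (hmeas : ∀ i, Measurable (x i)) (hlaw : ∀ i, P.map (x i) = μ)
    (hindep : iIndepFun x P) {U : Set X} (hU : MeasurableSet U) :
    TendstoInMeasure P (fun n ω => (empiricalMeasure (fun i => x i ω) n).real U) atTop
      (fun _ => μ.real U) := by
  have hf : Measurable (U.indicator (1 : X → ℝ)) := measurable_one.indicator hU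
  simp_rw [empiricalMeasure_real_apply _ _ hU]
  refine tendstoInMeasure_of_tendsto_ae (fun n => ?_) ?_
  · exact ((Finset.measurable_sum _ fun i _ => hf.comp (hmeas i)).div_const _).aestronglyMeasurable
  · have hint : P[fun ω => U.indicator (1 : X → ℝ) (x 0 ω)] = μ.real U := by
      rw [← hlaw 0, ← integral_map (hmeas 0).aemeasurable hf.aestronglyMeasurable,
        integral_indicator_one hU]
    rw [← hint]
    refine strong_law_ae_real (fun i ω => U.indicator (1 : X → ℝ) (x i ω)) ?_ ?_ fun i => ?_
    · refine Integrable.of_bound (hf.comp (hmeas 0)).aestronglyMeasurable 1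
        (ae_of_all _ fun ω => ?_)
      exact (norm_indicator_le_norm_self _ _).trans (by simp)
    · exact fun i j hij => (hindep.indepFun hij).comp hf hf
    · exact IdentDistrib.comp ⟨(hmeas i).aemeasurable, (hmeas 0).aemeasurable,
        (hlaw i).trans (hlaw 0).symm⟩ hf

end Empirical

/-- If the sample points lie in the support of `μ` and the empirical measure is close to `μ` on
finite unions of balls covering the support, then the measure Dowker bifiltration of the sample is
close to that of the support. -/
theorem dHI_sample_le {X : Type u} [MetricSpace X] [TopologicalSpace.SeparableSpace X]
    [MeasurableSpace X] [BorelSpace X] {μ : Measure X} [IsFiniteMeasure μ] {ε η : ℝ} (hε : 0 < ε)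
    (hηε : η ≤ ε) {t : Finset X} (hcover : μ.support ⊆ ⋃ a ∈ t, Metric.ball a (ε / 2))
    (hηt : ∀ a ∈ t, η ≤ μ.real (Metric.ball a (ε / 2))) {x : ℕ → X}
    (hx : ∀ i, x i ∈ μ.support) {n : ℕ}
    (h : ∀ S ⊆ t, dist ((empiricalMeasure x n).real (⋃ a ∈ S, Metric.ball a (ε / 2)))
      (μ.real (⋃ a ∈ S, Metric.ball a (ε / 2))) < η) :
    dHI (MD (sampleSet x n) (empiricalMeasure x n)) (MD μ.support μ) ≤ ENNReal.ofReal ε := by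
  have : SecondCountableTopology X := UniformSpace.secondCountable_of_separable X
  have hreal {α β : Measure X} [IsFiniteMeasure α] [IsFiniteMeasure β] {U : Set X}
      (hU : dist (α.real U) (β.real U) < η) : α U ≤ β U + ENNReal.ofReal ε := by
    rw [← ofReal_measureReal (μ := α), ← ofReal_measureReal (μ := β),
      ← ENNReal.ofReal_add measureReal_nonneg hε.le]
    refine ENNReal.ofReal_le_ofReal ?_
    linarith [(abs_lt.1 hU).2]
  have hdense : ∀ a ∈ μ.support, ∃ b ∈ sampleSet x n, dist b a ≤ ε := by
    intro a ha
    obtain ⟨c, hc, hac⟩ := Set.mem_iUnion₂.1 (hcover ha)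
    -- With no sample point within `ε` of `a`, the ball around `c` has empirical mass `0` but
    -- `μ`-mass at least `η`, against closeness on the one-ball union.
    by_contra! hcon
    have h0 : empiricalMeasure x n (Metric.ball c (ε / 2)) = 0 := by
      refine empiricalMeasure_eq_zero measurableSet_ball fun i hi hic => ?_
      have := hcon (x i) ⟨i, hi, rfl⟩
      linarith [dist_triangle_right (x i) a c, Metric.mem_ball.1 hic, Metric.mem_ball.1 hac]
    have h1 := h {c} (Finset.singleton_subset_iff.2 hc)
    simp only [Finset.mem_singleton, Set.iUnion_iUnion_eq_left, measureReal_def _ _, h0] at h1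
    rw [← measureReal_def, ENNReal.toReal_zero, dist_comm] at h1
    linarith [(abs_lt.1 h1).2, hηt c hc]
  have hsub : sampleSet x n ⊆ μ.support := by
    rintro _ ⟨i, -, rfl⟩
    exact hx i
  obtain ⟨φ, hφ, hφε⟩ := exists_surjective_dist_le hε.le hsub hdense
  refine dHI_MD_le hε hφ hφε (measure_le_thickening_add Measure.measure_compl_support hcover ?_)
    (measure_le_thickening_add (empiricalMeasure_eq_zero
      Measure.isClosed_support.measurableSet.compl fun i _ hi => hi (hx i)) hcover ?_)
  · exact fun S hS => hreal (by rw [dist_comm]; exact h S hS)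
  · exact fun S hS => hreal (h S hS)

end MeasureDowker

theorem mainTheorem3 {X : Type*} [MetricSpace X] [CompleteSpace X]
    [TopologicalSpace.SeparableSpace X] [MeasurableSpace X] [BorelSpace X]
    (μ : Measure X) [IsProbabilityMeasure μ] (hμ : IsCompact μ.support)
    {Ω : Type*} [MeasurableSpace Ω] (P : Measure Ω) [IsProbabilityMeasure P]
    (x : ℕ → Ω → X) (hmeas : ∀ i, Measurable (x i)) (hlaw : ∀ i, P.map (x i) = μ)
    (hindep : iIndepFun x P) (ε : ℝ) (hε : 0 < ε) :
    Tendsto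
      (fun n : ℕ => P {ω | ENNReal.ofReal ε <
        MeasureDowker.dHI
          (MeasureDowker.MD (MeasureDowker.sampleSet (fun i => x i ω) n)
            (MeasureDowker.empiricalMeasure (fun i => x i ω) n))
          (MeasureDowker.MD μ.support μ)})
      atTop (𝓝 0) := by
  have : SecondCountableTopology X := UniformSpace.secondCountable_of_separable X
  obtain ⟨t, htA, hcover⟩ := hμ.elim_nhds_subcover (fun a => Metric.ball a (ε / 2))
    fun a _ => Metric.ball_mem_nhds a (half_pos hε)
  have hpos : ∀ a ∈ t, 0 < μ.real (Metric.ball a (ε / 2)) := fun a ha =>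
    ENNReal.toReal_pos ((Measure.mem_support_iff_forall a).1 (htA a ha) _
      (Metric.ball_mem_nhds a (half_pos hε))).ne' (measure_ne_top _ _)
  -- The bound by `ε` controls the mass shift; the bound by the ball masses forces a sample point
  -- into every ball.
  obtain ⟨η, hη, hηε, hηt⟩ : ∃ η : ℝ, 0 < η ∧ η ≤ ε ∧
      ∀ a ∈ t, η ≤ μ.real (Metric.ball a (ε / 2)) := by
    have h (c : ℝ) (hc : 0 < c) : ∀ᶠ η in 𝓝[>] (0 : ℝ), η ≤ c :=
      mem_nhdsWithin_of_mem_nhds (Iic_mem_nhds hc)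
    have h0 : ∀ᶠ η in 𝓝[>] (0 : ℝ), 0 < η := self_mem_nhdsWithin
    exact (h0.and ((h ε hε).and
      ((eventually_all_finset t).2 fun a ha => h _ (hpos a ha)))).exists
  let U (S : Finset X) : Set X := ⋃ a ∈ S, Metric.ball a (ε / 2)
  let bad (n : ℕ) (S : Finset X) : Set Ω :=
    {ω | η ≤ dist ((MeasureDowker.empiricalMeasure (fun i => x i ω) n).real (U S)) (μ.real (U S))}
  have hbad : Tendsto (fun n => ∑ S ∈ t.powerset, P (bad n S)) atTop (𝓝 0) := by
    rw [← Finset.sum_const_zero (s := t.powerset)]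
    refine tendsto_finsetSum _ fun S _ => ?_
    exact tendstoInMeasure_iff_dist.1
      (MeasureDowker.tendstoInMeasure_empiricalMeasure hmeas hlaw hindep (S.measurableSet_biUnion fun a _ => measurableSet_ball)) η hη
  have hsupp : ∀ᵐ ω ∂P, ∀ i, x i ω ∈ μ.support := ae_all_iff.2 fun i =>
    ae_of_ae_map (hmeas i).aemeasurable (by rw [hlaw i]; exact Measure.support_mem_ae)
  refine tendsto_of_tendsto_of_tendsto_of_le_of_le tendsto_const_nhds hbad
    (fun _ => zero_le) fun n => ?_
  -- Monotonicity and subadditivity hold for the outer measure, so no event needs to be measurable.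
  refine le_trans (measure_mono_ae ?_) (measure_biUnion_finset_le t.powerset (bad n))
  filter_upwards [hsupp] with ω hω hlt
  by_contra hnot
  refine hlt.not_ge (MeasureDowker.dHI_sample_le hε hηε hcover hηt hω fun S hS => ?_)
  by_contra! hle
  exact hnot (Set.mem_iUnion₂.2 ⟨S, Finset.mem_powerset.2 hS, hle⟩)
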